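/- There is, for every $\eta\in(0,1/2)$, a constant $C>0$ depending only on $\eta$ such that the following holds. Let $N,d\ge 1$ be integers, let $p_1,\dots,p_N>0$ be known weights with $\sum_i p_i=1$, and let $\delta>0$. For a collection of $d$-dimensional quantum states (positive semidefinite trace-one matrices) $\rho_1,\dots,\rho_N$ put $$\rho=\sum_{i=1}^N p_i\,|i\rangle\langle i|\otimes\rho_i ,\qquad \mathcal M_{HS}^2(\rho)=\sum_{i=1}^N\sum_{j=1}^N p_ip_j\,\|\rho_i-\rho_j\|_2^2 ,$$ where $|1\rangle,\dots,|N\rangle$ is an orthonormal basis of $\mathbb C^N$ and $\|A\|_2=(\mathrm{Tr}[A^\dagger A])^{1/2}$. Then for every integer $M\ge C\sqrt N/\delta$ there is a two-outcome POVM $\{E_{\mathrm{acc}},E_{\mathrm{rej}}\}$ on $(\mathbb C^N\otimes\mathbb C^d)^{\otimes M}$, which may depend on $N,d,p,\delta,M,\eta$ but not on the states $\rho_i$, such that for all collections $\rho_1,\dots,\rho_N$: * if $\mathcal M_{HS}^2(\rho)\le 0.99\,\delta$, then $\mathrm{Tr}[E_{\mathrm{acc}}\,\rho^{\otimes M}]>1-\eta$;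 * if $\mathcal M_{HS}^2(\rho)>\delta$, then $\mathrm{Tr}[E_{\mathrm{acc}}\,\rho^{\otimes M}]<\eta$. That is, $O(\sqrt N/\delta)$ copies of $\rho$ suffice to distinguish the two cases with high probability (for instance with $\eta=1/3$). -/

import Mathlib

open scoped ComplexOrder

namespace QuantumCollection

/-- A quantum state on the finite-dimensional Hilbert space with orthonormal basis indexed by `ι`:
a positive semidefinite operator of trace one. -/
def IsState {ι : Type*} [Fintype ι] (σ : Matrix ι ι ℂ) : Prop :=
  σ.PosSemidef ∧ σ.trace = 1

/-- The Hilbert–Schmidt distance `‖σ - τ‖₂ = (Tr[(σ - τ)† (σ - τ)])^{1/2}`. -/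
noncomputable def distHS {ι : Type*} [Fintype ι] (σ τ : Matrix ι ι ℂ) : ℝ :=
  Real.sqrt (((σ - τ).conjTranspose * (σ - τ)).trace).re

/-- The state `∑ i, p i |i⟩⟨i| ⊗ ρ i` on `ℂ^N ⊗ ℂ^d`. -/
noncomputable def samplingState {N d : ℕ} (p : Fin N → ℝ)
    (ρ : Fin N → Matrix (Fin d) (Fin d) ℂ) : Matrix (Fin N × Fin d) (Fin N × Fin d) ℂ :=
  ∑ i, (p i : ℂ) • Matrix.kronecker (Matrix.single i i (1 : ℂ)) (ρ i)

/-- The root mean squared Hilbert–Schmidt distance of the collection `ρ` with weights `p`: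
`(∑ i, ∑ j, p i * p j * D_HS(ρ i, ρ j) ^ 2)^{1/2}`. -/
noncomputable def meanHS {N d : ℕ} (p : Fin N → ℝ)
    (ρ : Fin N → Matrix (Fin d) (Fin d) ℂ) : ℝ :=
  Real.sqrt (∑ i, ∑ j, p i * p j * distHS (ρ i) (ρ j) ^ 2)

/-- The tensor power `A^{⊗M}`, in the product basis indexed by `Fin M → ι`. -/
def tensorPower {ι : Type*} (M : ℕ) (A : Matrix ι ι ℂ) :
    Matrix (Fin M → ι) (Fin M → ι) ℂ :=
  Matrix.of fun x y => ∏ k, A (x k) (y k)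

/-- A two-outcome test (positive operator valued measure) on `M` copies of a system with basis
indexed by `ι`; the outcomes are "accept" and "reject". -/
structure TwoOutcomeTest (ι : Type*) [Fintype ι] [DecidableEq ι] (M : ℕ) where
  accept : Matrix (Fin M → ι) (Fin M → ι) ℂ
  reject : Matrix (Fin M → ι) (Fin M → ι) ℂ
  accept_posSemidef : accept.PosSemidef
  reject_posSemidef : reject.PosSemidef
  add_eq_one : accept + reject = 1

/-- The probability `Tr[E_accept σ^{⊗M}]` that the test accepts when given `M` copies of `σ`. -/
noncomputable def TwoOutcomeTest.acceptProb {ι : Type*} [Fintype ι] [DecidableEq ι] {M : ℕ}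
    (T : TwoOutcomeTest ι M) (σ : Matrix ι ι ℂ) : ℝ :=
  ((T.accept * tensorPower M σ).trace).re

end QuantumCollection

/-! The quantity to be tested is a variance. Put `θ = meanHS² / 2`, `ρ̄ = ∑ p_i ρ_i` and `Δ_i = ρ_i
- ρ̄`. Then `θ = ∑ p_i Tr Δ_i² = ∑ p_i Tr (ρ_i Δ_i)`, which is linear in two copies of the sampling
state. It is the expectation of the swap of the second registers of two copies, weighted by `[i = j]
/ p_i - 1` when the first registers read `i, j` (`pairOp`, `trace_pairOp`). The weight needs `p` but
not the states.

The test measures the sum of these observables over all ordered pairs of distinct copies and accepts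
when the value lies below a threshold. Chebyshev's inequality then needs a variance bound, which
comes from how two pairs overlap. Disjoint pairs are uncorrelated (`trace_pairOp_mul_of_disjoint`).
Pairs sharing one copy contribute `∑ p_i Tr (ρ_i Δ_i²) ≤ θ` (`trace_pairOp_mul_of_shared`). For
coinciding pairs the swaps cancel, leaving the second moment of the weight, at most `N`
(`trace_pairOp_mul_self`).

The variance is thus at most `M(M-1)(4Mθ + 2N)` (`trace_dispersionOp_sq_le`). Against the squared
gap `(M(M-1)g)²` this is of order `θ/(M g²) + N/(M² g²)`. Since `g` is at least a constant times `δ`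
or `θ`, both terms are small once `M` is a large multiple of `√N/δ`. -/

namespace QuantumCollection

/-! ### Functional calculus and the outcome distribution of an observable -/

section Spectral
variable {n : Type*} [Fintype n] [DecidableEq n]

/-- The function `f` applied to the Hermitian matrix `A` through its spectral decomposition. -/
noncomputable def spectralMap {A : Matrix n n ℂ} (hA : A.IsHermitian) (f : ℝ → ℝ) : Matrix n n ℂ :=
  (hA.eigenvectorUnitary : Matrix n n ℂ) * Matrix.diagonal (fun k => ((f (hA.eigenvalues k) : ℝ) : ℂ)) *
    (hA.eigenvectorUnitary : Matrix n n ℂ).conjTranspose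

/-- The weight of `S` on the `k`-th eigenvector of `A`. -/
noncomputable def spectralWeight {A : Matrix n n ℂ} (hA : A.IsHermitian) (S : Matrix n n ℂ)
    (k : n) : ℝ :=
  (((hA.eigenvectorUnitary : Matrix n n ℂ).conjTranspose * S *
    (hA.eigenvectorUnitary : Matrix n n ℂ)) k k).re

variable {A : Matrix n n ℂ} (hA : A.IsHermitian)

lemma eigenvectorUnitary_mul_conjTranspose :
    (hA.eigenvectorUnitary : Matrix n n ℂ) * (hA.eigenvectorUnitary : Matrix n n ℂ).conjTranspose
      = 1 :=
  Unitary.coe_mul_star_self hA.eigenvectorUnitary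

lemma conjTranspose_mul_eigenvectorUnitary :
    (hA.eigenvectorUnitary : Matrix n n ℂ).conjTranspose * (hA.eigenvectorUnitary : Matrix n n ℂ)
      = 1 :=
  Unitary.coe_star_mul_self hA.eigenvectorUnitary

lemma spectralMap_id : spectralMap hA (fun t => t) = A := by
  conv_rhs => rw [hA.spectral_theorem]
  rfl

lemma spectralMap_one : spectralMap hA (fun _ => 1) = 1 := by
  simp [spectralMap, eigenvectorUnitary_mul_conjTranspose]

lemma spectralMap_add (f g : ℝ → ℝ) :
    spectralMap hA f + spectralMap hA g = spectralMap hA (fun t => f t + g t) := by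
  unfold spectralMap
  rw [← add_mul, ← mul_add, Matrix.diagonal_add]
  simp

lemma spectralMap_mul (f g : ℝ → ℝ) :
    spectralMap hA f * spectralMap hA g = spectralMap hA (fun t => f t * g t) := by
  unfold spectralMap
  set U := (hA.eigenvectorUnitary : Matrix n n ℂ)
  have h : U.conjTranspose * U = 1 := conjTranspose_mul_eigenvectorUnitary hA
  calc _ = U * Matrix.diagonal (fun k => ((f (hA.eigenvalues k) : ℝ) : ℂ)) *
        (U.conjTranspose * U) * Matrix.diagonal (fun k => ((g (hA.eigenvalues k) : ℝ) : ℂ)) *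
        U.conjTranspose := by simp only [Matrix.mul_assoc]
    _ = _ := by rw [h, Matrix.mul_one, Matrix.mul_assoc U, Matrix.diagonal_mul_diagonal]; simp

lemma spectralMap_posSemidef {f : ℝ → ℝ} (hf : ∀ t, 0 ≤ f t) : (spectralMap hA f).PosSemidef := by
  unfold spectralMap
  apply Matrix.PosSemidef.mul_mul_conjTranspose_same
  rw [Matrix.posSemidef_diagonal_iff]
  intro k
  exact_mod_cast hf _

lemma trace_spectralMap_mul (f : ℝ → ℝ) (S : Matrix n n ℂ) :
    ((spectralMap hA f * S).trace).re = ∑ k, f (hA.eigenvalues k) * spectralWeight hA S k := by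
  unfold spectralMap spectralWeight
  rw [Matrix.mul_assoc, Matrix.mul_assoc, Matrix.trace_mul_comm, Matrix.mul_assoc, Matrix.trace,
    Complex.re_sum]
  refine Finset.sum_congr rfl fun k _ => ?_
  rw [Matrix.diag_apply, Matrix.diagonal_mul, Complex.re_ofReal_mul]

lemma spectralWeight_nonneg {S : Matrix n n ℂ} (hS : S.PosSemidef) (k : n) :
    0 ≤ spectralWeight hA S k := by
  have h := (hS.conjTranspose_mul_mul_same (hA.eigenvectorUnitary : Matrix n n ℂ)).diag_nonneg
    (i := k)
  exact (Complex.le_def.1 h).1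

lemma sum_spectralWeight (S : Matrix n n ℂ) : ∑ k, spectralWeight hA S k = S.trace.re := by
  have h := trace_spectralMap_mul hA (fun _ => 1) S
  rw [spectralMap_one, Matrix.one_mul] at h
  simpa using h.symm

end Spectral

/-! ### Trace inequalities for positive semidefinite matrices -/

section PositiveTrace
variable {n : Type*} [Fintype n] [DecidableEq n]

lemma trace_mul_re_nonneg {A B : Matrix n n ℂ} (hA : A.PosSemidef) (hB : B.PosSemidef) :
    0 ≤ (A * B).trace.re := by
  have h := trace_spectralMap_mul hA.isHermitian (fun t => t) B
  rw [spectralMap_id] at h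
  rw [h]
  exact Finset.sum_nonneg fun k _ =>
    mul_nonneg (hA.eigenvalues_nonneg k) (spectralWeight_nonneg _ hB k)

/-- The eigenvalues of a state are nonnegative with sum one, so each is at most one. -/
lemma IsState.trace_mul_re_le {A B : Matrix n n ℂ} (hA : IsState A) (hB : B.PosSemidef) :
    (A * B).trace.re ≤ B.trace.re := by
  have h := trace_spectralMap_mul hA.1.isHermitian (fun t => t) B
  rw [spectralMap_id] at h
  rw [h, ← sum_spectralWeight hA.1.isHermitian B]
  refine Finset.sum_le_sum fun k _ => ?_
  refine mul_le_of_le_one_left (spectralWeight_nonneg _ hB k) ?_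
  have h1 : ∑ k, hA.1.isHermitian.eigenvalues k = 1 := by
    have := hA.1.isHermitian.trace_eq_sum_eigenvalues
    have h2 := congrArg Complex.re (this.symm.trans hA.2)
    simpa using h2
  rw [← h1]
  exact Finset.single_le_sum (f := hA.1.isHermitian.eigenvalues)
    (fun j _ => hA.1.eigenvalues_nonneg j) (Finset.mem_univ k)

end PositiveTrace

/-! ### Chebyshev's inequality for a threshold measurement -/

section Chebyshev

/-- Accept when the observable `A` takes a value at most `t`. -/
noncomputable def thresholdTest {ι : Type*} [Fintype ι] [DecidableEq ι] {M : ℕ}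
    {A : Matrix (Fin M → ι) (Fin M → ι) ℂ} (hA : A.IsHermitian) (t : ℝ) : TwoOutcomeTest ι M where
  accept := spectralMap hA (fun s => if s ≤ t then 1 else 0)
  reject := spectralMap hA (fun s => if s ≤ t then 0 else 1)
  accept_posSemidef := spectralMap_posSemidef hA fun s => by split_ifs <;> norm_num
  reject_posSemidef := spectralMap_posSemidef hA fun s => by split_ifs <;> norm_num
  add_eq_one := by
    rw [spectralMap_add, ← spectralMap_one hA]
    congr 1
    ext s
    split_ifs <;> norm_num

variable {ι : Type*} [Fintype ι] [DecidableEq ι] {M : ℕ}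
    {A : Matrix (Fin M → ι) (Fin M → ι) ℂ} (hA : A.IsHermitian) {σ : Matrix ι ι ℂ}
    (hS : (tensorPower M σ).PosSemidef) (hS1 : (tensorPower M σ).trace = 1) {e V : ℝ}
    (he : ((A * tensorPower M σ).trace).re = e)
    (hV : ((A * A * tensorPower M σ).trace).re ≤ e ^ 2 + V)
include hS1 he hV

/-- The weights of `σ^{⊗M}` on the eigenvectors of `A` form the law of the measured value, with mean
`e` and second moment at most `e ^ 2 + V`; expanding the square gives the variance. -/
lemma sum_sq_sub_mean_le :
    ∑ k, (hA.eigenvalues k - e) ^ 2 * spectralWeight hA (tensorPower M σ) k ≤ V := by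
  have h0 := sum_spectralWeight hA (tensorPower M σ)
  have h1 := trace_spectralMap_mul hA (fun t => t) (tensorPower M σ)
  have h2 := trace_spectralMap_mul hA (fun t => t * t) (tensorPower M σ)
  rw [← spectralMap_mul] at h2
  rw [spectralMap_id] at h1 h2
  rw [hS1] at h0
  have : ∑ k, (hA.eigenvalues k - e) ^ 2 * spectralWeight hA (tensorPower M σ) k
      = ∑ k, hA.eigenvalues k * hA.eigenvalues k * spectralWeight hA (tensorPower M σ) k
        - 2 * e * ∑ k, hA.eigenvalues k * spectralWeight hA (tensorPower M σ) k
        + e ^ 2 * ∑ k, spectralWeight hA (tensorPower M σ) k := by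
    rw [Finset.mul_sum, Finset.mul_sum, ← Finset.sum_sub_distrib, ← Finset.sum_add_distrib]
    exact Finset.sum_congr rfl fun k _ => by ring
  rw [this, ← h1, ← h2, h0, he]
  simp only [Complex.one_re]
  nlinarith

include hS

/-- Every accepted eigenvalue is at distance at least `e - t` from the mean, so Chebyshev's
inequality applies termwise. -/
lemma thresholdTest_acceptProb_le {t : ℝ} (ht : t < e) :
    (thresholdTest hA t).acceptProb σ ≤ V / (e - t) ^ 2 := by
  rw [le_div_iff₀ (by nlinarith [sub_pos.2 ht])]
  refine le_trans ?_ (sum_sq_sub_mean_le hA hS1 he hV)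
  unfold TwoOutcomeTest.acceptProb thresholdTest
  rw [trace_spectralMap_mul, Finset.sum_mul]
  refine Finset.sum_le_sum fun k _ => ?_
  have hw := spectralWeight_nonneg hA hS k
  split_ifs with h
  · rw [one_mul, mul_comm]
    exact mul_le_mul_of_nonneg_right (by nlinarith) hw
  · rw [zero_mul, zero_mul]
    positivity

lemma one_sub_le_thresholdTest_acceptProb {t : ℝ} (ht : e < t) :
    1 - V / (t - e) ^ 2 ≤ (thresholdTest hA t).acceptProb σ := by
  have h0 := sum_spectralWeight hA (tensorPower M σ)
  rw [hS1, Complex.one_re] at h0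
  rw [sub_le_comm, le_div_iff₀ (by nlinarith [sub_pos.2 ht])]
  refine le_trans ?_ (sum_sq_sub_mean_le hA hS1 he hV)
  have h1 : 1 - (thresholdTest hA t).acceptProb σ = ∑ k, (spectralWeight hA (tensorPower M σ) k -
      (if hA.eigenvalues k ≤ t then 1 else 0) * spectralWeight hA (tensorPower M σ) k) := by
    unfold TwoOutcomeTest.acceptProb thresholdTest
    rw [trace_spectralMap_mul, Finset.sum_sub_distrib, h0]
  rw [h1, Finset.sum_mul]
  refine Finset.sum_le_sum fun k _ => ?_
  have hw := spectralWeight_nonneg hA hS k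
  split_ifs with h
  · rw [one_mul, sub_self, zero_mul]
    positivity
  · rw [zero_mul, sub_zero, mul_comm]
    exact mul_le_mul_of_nonneg_right (by nlinarith) hw

end Chebyshev

/-! ### Tensor powers of states -/

section TensorPower
variable {ι : Type*} [Fintype ι] {M : ℕ}

lemma tensorPower_mul (A B : Matrix ι ι ℂ) :
    tensorPower M (A * B) = tensorPower M A * tensorPower M B := by
  ext x y
  simp only [tensorPower, Matrix.of_apply, Matrix.mul_apply, Finset.prod_univ_sum,
    Fintype.piFinset_univ, Finset.prod_mul_distrib]

omit [Fintype ι] in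
lemma tensorPower_conjTranspose (A : Matrix ι ι ℂ) :
    tensorPower M A.conjTranspose = (tensorPower M A).conjTranspose := by
  ext x y
  simp [tensorPower, Matrix.conjTranspose_apply]

open scoped MatrixOrder in
-- A factorization `A = B†B` passes to tensor powers: `A^{⊗M} = (B^{⊗M})† B^{⊗M}`.
lemma IsState.tensorPower_posSemidef [DecidableEq ι] {A : Matrix ι ι ℂ} (hA : IsState A) :
    (tensorPower M A).PosSemidef := by
  obtain ⟨B, rfl⟩ := CStarAlgebra.nonneg_iff_eq_star_mul_self.mp hA.1.nonneg
  rw [Matrix.star_eq_conjTranspose, tensorPower_mul, tensorPower_conjTranspose]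
  exact Matrix.posSemidef_conjTranspose_mul_self _

lemma IsState.tensorPower_trace {A : Matrix ι ι ℂ} (hA : IsState A) :
    (tensorPower M A).trace = 1 := by
  have h : ∏ _k : Fin M, A.trace = 1 := by simp [hA.2]
  rw [← h]
  simp only [Matrix.trace, Matrix.diag, Finset.prod_univ_sum, Fintype.piFinset_univ, tensorPower,
    Matrix.of_apply]

end TensorPower

/-! ### The sampling state as a block-diagonal state -/

section SamplingState
variable {N d : ℕ} {p : Fin N → ℝ} {ρ : Fin N → Matrix (Fin d) (Fin d) ℂ}

lemma samplingState_apply (p : Fin N → ℝ) (ρ : Fin N → Matrix (Fin d) (Fin d) ℂ)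
    (x y : Fin N × Fin d) :
    samplingState p ρ x y = if x.1 = y.1 then (p x.1 : ℂ) * ρ x.1 x.2 y.2 else 0 := by
  simp only [samplingState, Matrix.sum_apply, Matrix.smul_apply, Matrix.kronecker,
    Matrix.kroneckerMap_apply, smul_eq_mul, Matrix.single_apply]
  split_ifs with h
  · rw [Finset.sum_eq_single x.1]
    · simp [h]
    · intro i _ hi
      simp [hi]
    · simp
  · refine Finset.sum_eq_zero fun i _ => ?_
    rw [if_neg (fun hi => h (hi.1.symm.trans hi.2))]
    simp

lemma samplingState_isState (hp : ∀ i, 0 < p i) (hp1 : ∑ i, p i = 1) (hρ : ∀ i, IsState (ρ i)) :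
    IsState (samplingState p ρ) := by
  constructor
  · unfold samplingState
    refine Matrix.posSemidef_sum _ fun i _ => ?_
    refine Matrix.PosSemidef.smul (Matrix.PosSemidef.kronecker ?_ (hρ i).1) ?_
    · have : Matrix.single i i (1 : ℂ) = Matrix.diagonal (Pi.single i 1) :=
        (Matrix.diagonal_single i (1 : ℂ)).symm
      rw [this, Matrix.posSemidef_diagonal_iff]
      intro j
      by_cases h : j = i
      · subst h; simp
      · simp [h]
    · exact_mod_cast (hp i).le
  · have h : ∀ i, ∑ s, ρ i s s = 1 := fun i => (hρ i).2
    simp only [Matrix.trace, Matrix.diag, samplingState_apply, if_true, Fintype.sum_prod_type,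
      ← Finset.mul_sum, h, mul_one]
    exact_mod_cast hp1

end SamplingState

/-! ### Summing out unused copies -/

section Marginal

lemma sum_fin_succ_pi {ι : Type*} [Fintype ι] {k : ℕ} (F : (Fin (k + 1) → ι) → ℂ) :
    ∑ y, F y = ∑ i, ∑ y : Fin k → ι, F (Matrix.vecCons i y) := by
  rw [← Fintype.sum_prod_type']
  exact (Fintype.sum_equiv (Fin.consEquiv fun _ => ι) _ _ fun _ => rfl).symm

/-- Coordinates outside the range of `e`, weighted by `q` of total mass one, sum out. -/
lemma sum_comp_mul_prod_compl {ι κ μ : Type*} [Fintype ι] [Fintype κ] [Fintype μ]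
    [DecidableEq κ] [DecidableEq μ]
    {e : κ → μ} (he : Function.Injective e) {q : ι → ℂ} (hq : ∑ y, q y = 1)
    (F : (κ → ι) → ℂ) :
    ∑ x : μ → ι, F (x ∘ e) * ∏ j ∈ (Finset.univ.image e)ᶜ, q (x j) = ∑ y, F y := by
  classical
  -- Splits an assignment into its coordinates in the range of `e`, reindexed by `κ`, and the
  -- remaining ones.
  let E : (μ → ι) ≃ (κ → ι) × ({j // ¬ j ∈ Set.range e} → ι) :=
    (Equiv.piEquivPiSubtypeProd (fun j => j ∈ Set.range e) (fun _ => ι)).trans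
      (Equiv.prodCongr ((Equiv.ofInjective e he).symm.arrowCongr (Equiv.refl ι)) (Equiv.refl _))
  have h : ∀ x, F (x ∘ e) * ∏ j ∈ (Finset.univ.image e)ᶜ, q (x j)
      = (fun z : (κ → ι) × ({j // ¬ j ∈ Set.range e} → ι) => F z.1 * ∏ j, q (z.2 j)) (E x) := by
    intro x
    have h1 : (E x).1 = x ∘ e := by
      ext k
      simp [E]
    have h2 : ∀ j, (E x).2 j = x j := fun j => rfl
    simp only [h1, h2]
    congr 1
    exact Finset.prod_subtype _ (by simp) _
  rw [Fintype.sum_equiv E _ (fun z => F z.1 * ∏ j, q (z.2 j)) h, Fintype.sum_prod_type]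
  have h3 : ∑ z : {j // ¬ j ∈ Set.range e} → ι, ∏ j, q (z j) = 1 := by
    rw [← Fintype.piFinset_univ, ← Finset.prod_univ_sum]
    simp [hq]
  simp only [← Finset.mul_sum, h3, mul_one]

end Marginal

/-! ### Weighted permutations of the second registers -/

section PermOp
variable {N d M : ℕ}

/-- Permute the second registers of a basis vector. -/
def permSnd (π : Equiv.Perm (Fin M)) (x : Fin M → Fin N × Fin d) : Fin M → Fin N × Fin d :=
  fun k => ((x k).1, (x (π k)).2)

/-- The operator permuting the second registers by `π`, weighted by a function `w` of the
first registers. -/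
def permOp (d : ℕ) (π : Equiv.Perm (Fin M)) (w : (Fin M → Fin N) → ℂ) :
    Matrix (Fin M → Fin N × Fin d) (Fin M → Fin N × Fin d) ℂ :=
  Matrix.of fun x y => if permSnd π x = y then w (fun k => (x k).1) else 0

/-- The first registers are left in place, so the weights commute with the permutations and multiply
pointwise. -/
lemma permOp_mul (π π' : Equiv.Perm (Fin M)) (w w' : (Fin M → Fin N) → ℂ) :
    permOp d π w * permOp d π' w' = permOp d (π * π') (fun I => w I * w' I) := by
  ext x z
  simp only [permOp, Matrix.mul_apply, Matrix.of_apply, ite_mul, zero_mul, mul_ite,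
    mul_zero]
  rw [Finset.sum_eq_single (permSnd π x)]
  · rw [if_pos rfl]
    rfl
  · intro y _ hy
    simp [hy.symm]
  · simp

lemma permOp_isHermitian {π : Equiv.Perm (Fin M)} (hπ : π * π = 1) {w : (Fin M → Fin N) → ℂ}
    (hw : ∀ I, star (w I) = w I) : (permOp d π w).IsHermitian := by
  have hinv : ∀ x : Fin M → Fin N × Fin d, permSnd π (permSnd π x) = x := by
    intro x
    ext k
    · rfl
    · have : π (π k) = k := by rw [← Equiv.Perm.mul_apply, hπ, Equiv.Perm.one_apply]
      simp [permSnd, this]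
  ext x y
  simp only [permOp, Matrix.conjTranspose_apply, Matrix.of_apply]
  by_cases h : permSnd π x = y
  · subst h
    rw [if_pos (hinv x), if_pos rfl, hw]
    rfl
  · rw [if_neg h, if_neg, star_zero]
    rintro rfl
    exact h (hinv y)

variable {p : Fin N → ℝ} {ρ : Fin N → Matrix (Fin d) (Fin d) ℂ}

lemma trace_permOp_mul_tensorPower (π : Equiv.Perm (Fin M)) (w : (Fin M → Fin N) → ℂ) :
    (permOp d π w * tensorPower M (samplingState p ρ)).trace
      = ∑ x : Fin M → Fin N × Fin d, w (fun k => (x k).1) *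
          ∏ k, ((p (x k).1 : ℂ) * ρ (x k).1 (x (π k)).2 (x k).2) := by
  simp only [Matrix.trace, Matrix.diag, Matrix.mul_apply, permOp, Matrix.of_apply, ite_mul,
    zero_mul, Finset.sum_ite_eq, Finset.mem_univ, if_true, tensorPower, samplingState_apply,
    permSnd]

/-- Each copy fixed by `π` and outside the range of `e` contributes only the trace of the sampling
state, which is one. This reduces moments on `M` copies to sums over at most four copies. -/
lemma trace_permOp_mul_tensorPower_of_injective (hp1 : ∑ i, p i = 1) (hρ : ∀ i, IsState (ρ i))
    {k : ℕ} {e : Fin k → Fin M} (he : Function.Injective e) {π : Equiv.Perm (Fin M)}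
    {π' : Equiv.Perm (Fin k)} (hπ : ∀ j, π (e j) = e (π' j))
    (hfix : ∀ j, (∀ i, e i ≠ j) → π j = j) (w : (Fin k → Fin N) → ℂ) :
    (permOp d π (fun I => w (I ∘ e)) * tensorPower M (samplingState p ρ)).trace
      = ∑ y : Fin k → Fin N × Fin d, w (fun j => (y j).1) *
          ∏ j, ((p (y j).1 : ℂ) * ρ (y j).1 (y (π' j)).2 (y j).2) := by
  have hq : ∑ y : Fin N × Fin d, ((p y.1 : ℂ) * ρ y.1 y.2 y.2) = 1 := by
    have h : ∀ i, ∑ s, ρ i s s = 1 := fun i => (hρ i).2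
    simp only [Fintype.sum_prod_type, ← Finset.mul_sum, h, mul_one]
    exact_mod_cast hp1
  rw [trace_permOp_mul_tensorPower, ← sum_comp_mul_prod_compl he hq]
  refine Finset.sum_congr rfl fun x _ => ?_
  rw [mul_assoc]
  congr 1
  rw [← Finset.prod_mul_prod_compl (Finset.univ.image e), Finset.prod_image he.injOn]
  congr 1
  · exact Finset.prod_congr rfl fun j _ => by simp [hπ]
  · refine Finset.prod_congr rfl fun j hj => ?_
    rw [hfix j]
    simpa using hj

end PermOp

/-! ### The pair weight, deviations from the mean state, and the dispersion -/

section Weights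
variable {N d : ℕ}

/-- The weight `[i = j] / p i - 1` making the weighted swap an unbiased estimator. -/
noncomputable def pairWeight (p : Fin N → ℝ) (i j : Fin N) : ℝ :=
  (if i = j then (p i)⁻¹ else 0) - 1

lemma pairWeight_comm (p : Fin N → ℝ) (i j : Fin N) : pairWeight p i j = pairWeight p j i := by
  unfold pairWeight
  by_cases h : i = j
  · subst h; rfl
  · rw [if_neg h, if_neg (Ne.symm h)]

variable {p : Fin N → ℝ} {ρ : Fin N → Matrix (Fin d) (Fin d) ℂ}

/-- Since `p j * pairWeight p i j = [i = j] - p j`, averaging against the weight subtracts the mean.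
-/
lemma sum_pairWeight_smul {V : Type*} [AddCommGroup V] [Module ℂ V] (hp : ∀ i, 0 < p i)
    (i : Fin N) (F : Fin N → V) :
    ∑ j, ((p j : ℂ) * (pairWeight p i j : ℂ)) • F j = F i - ∑ j, (p j : ℂ) • F j := by
  have h : ∀ j, ((p j : ℂ) * (pairWeight p i j : ℂ)) • F j
      = (if i = j then F j else 0) - (p j : ℂ) • F j := by
    intro j
    unfold pairWeight
    by_cases hij : i = j
    · subst hij
      have : (p i : ℂ) ≠ 0 := by exact_mod_cast (hp i).ne'
      rw [if_pos rfl, if_pos rfl, Complex.ofReal_sub, Complex.ofReal_inv, mul_sub,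
        mul_inv_cancel₀ this, sub_smul]
      simp
    · rw [if_neg hij, if_neg hij]
      simp
  simp only [h, Finset.sum_sub_distrib, Finset.sum_ite_eq, Finset.mem_univ, if_true]

/-- The diagonal terms are `1 - 2 p i + p i ^ 2` and the others `p i * p j`, so the sum is exactly
`N - 1`, whatever `p` is. This is the source of `√N` in the number of copies. -/
lemma sum_pairWeight_sq_le (hp : ∀ i, 0 < p i) (hp1 : ∑ i, p i = 1) :
    ∑ i, ∑ j, p i * p j * (pairWeight p i j * pairWeight p i j) ≤ N := by
  have h : ∀ i j, p i * p j * (pairWeight p i j * pairWeight p i j)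
      = (if i = j then 1 - 2 * p i else 0) + p i * p j := by
    intro i j
    unfold pairWeight
    by_cases hij : i = j
    · subst hij
      have := (hp i).ne'
      rw [if_pos rfl, if_pos rfl]
      field_simp
      ring
    · rw [if_neg hij, if_neg hij]
      ring
  simp only [h, Finset.sum_add_distrib, Finset.sum_ite_eq, Finset.mem_univ, if_true,
    ← Finset.mul_sum, hp1, mul_one, Finset.sum_sub_distrib, Finset.sum_const, Finset.card_univ,
    Fintype.card_fin, nsmul_eq_mul]
  linarith

/-- The deviation of `ρ i` from the average state. -/
noncomputable def deviation (p : Fin N → ℝ) (ρ : Fin N → Matrix (Fin d) (Fin d) ℂ) (i : Fin N) :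
    Matrix (Fin d) (Fin d) ℂ :=
  ∑ j, ((p j : ℂ) * (pairWeight p i j : ℂ)) • ρ j

lemma deviation_eq (hp : ∀ i, 0 < p i) (i : Fin N) :
    deviation p ρ i = ρ i - ∑ j, (p j : ℂ) • ρ j :=
  sum_pairWeight_smul hp i ρ

lemma deviation_isHermitian (hρ : ∀ i, IsState (ρ i)) (i : Fin N) :
    (deviation p ρ i).IsHermitian := by
  unfold deviation Matrix.IsHermitian
  rw [Matrix.conjTranspose_sum]
  refine Finset.sum_congr rfl fun j _ => ?_
  rw [Matrix.conjTranspose_smul, (hρ j).1.isHermitian.eq, ← Complex.ofReal_mul]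
  simp

/-- Half the squared mean Hilbert–Schmidt distance. -/
noncomputable def dispersion (p : Fin N → ℝ) (ρ : Fin N → Matrix (Fin d) (Fin d) ℂ) : ℝ :=
  meanHS p ρ ^ 2 / 2

lemma distHS_sq {ι : Type*} [Fintype ι] (σ τ : Matrix ι ι ℂ) :
    ((distHS σ τ ^ 2 : ℝ) : ℂ) = ((σ - τ).conjTranspose * (σ - τ)).trace := by
  have h := Complex.le_def.1 (Matrix.posSemidef_conjTranspose_mul_self (σ - τ)).trace_nonneg
  rw [distHS, Real.sq_sqrt h.1]
  exact Complex.ext rfl h.2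

lemma meanHS_sq (hp : ∀ i, 0 < p i) :
    meanHS p ρ ^ 2 = ∑ i, ∑ j, p i * p j * distHS (ρ i) (ρ j) ^ 2 := by
  refine Real.sq_sqrt (Finset.sum_nonneg fun i _ => Finset.sum_nonneg fun j _ => ?_)
  have := hp i
  have := hp j
  positivity

/-- Expanding, `‖ρ i - ρ j‖² = Tr ρ_i² + Tr ρ_j² - 2 Tr ρ_i ρ_j`, where the purities are at most one
and the overlap is nonnegative. The bound disposes of the case of fewer than two copies. -/
lemma meanHS_sq_le_two (hp : ∀ i, 0 < p i) (hp1 : ∑ i, p i = 1) (hρ : ∀ i, IsState (ρ i)) :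
    meanHS p ρ ^ 2 ≤ 2 := by
  have h : ∀ i j, distHS (ρ i) (ρ j) ^ 2 ≤ 2 := by
    intro i j
    have h := congrArg Complex.re (distHS_sq (ρ i) (ρ j))
    rw [Complex.ofReal_re] at h
    rw [h, Matrix.conjTranspose_sub, (hρ i).1.isHermitian.eq, (hρ j).1.isHermitian.eq, sub_mul,
      mul_sub, mul_sub]
    simp only [Matrix.trace_sub, Complex.sub_re]
    have h1 := (hρ i).trace_mul_re_le (hρ i).1
    have h2 := (hρ j).trace_mul_re_le (hρ j).1
    have h3 := trace_mul_re_nonneg (hρ i).1 (hρ j).1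
    have h4 := trace_mul_re_nonneg (hρ j).1 (hρ i).1
    rw [(hρ i).2, Complex.one_re] at h1
    rw [(hρ j).2, Complex.one_re] at h2
    linarith
  rw [meanHS_sq hp]
  calc _ ≤ ∑ i, ∑ j, p i * p j * 2 := Finset.sum_le_sum fun i _ => Finset.sum_le_sum fun j _ =>
        mul_le_mul_of_nonneg_left (h i j) (mul_pos (hp i) (hp j)).le
    _ = 2 := by simp only [← Finset.sum_mul, ← Finset.mul_sum, hp1]; norm_num

lemma dispersion_nonneg : 0 ≤ dispersion p ρ := by
  unfold dispersion
  positivity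

/-- The variance identity: half the mean squared distance of two independent samples is the mean
purity minus the purity of the mean state. -/
lemma dispersion_eq_purity_sub (hp : ∀ i, 0 < p i) (hp1 : ∑ i, p i = 1)
    (hρ : ∀ i, IsState (ρ i)) :
    (dispersion p ρ : ℂ) = ∑ i, (p i : ℂ) * (ρ i * ρ i).trace -
      ((∑ i, (p i : ℂ) • ρ i) * ∑ i, (p i : ℂ) • ρ i).trace := by
  have h1 : ∑ i, (p i : ℂ) = 1 := by exact_mod_cast hp1
  have hbar : ((∑ i, (p i : ℂ) • ρ i) * ∑ i, (p i : ℂ) • ρ i).trace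
      = ∑ i, ∑ j, (p i : ℂ) * p j * (ρ i * ρ j).trace := by
    simp only [Finset.sum_mul, Finset.mul_sum, Matrix.trace_sum, Matrix.smul_mul, Matrix.mul_smul,
      Matrix.trace_smul, smul_eq_mul, mul_assoc]
    rw [Finset.sum_comm]
    refine Finset.sum_congr rfl fun i _ => Finset.sum_congr rfl fun j _ => ?_
    ring
  have h2 : ((meanHS p ρ ^ 2 : ℝ) : ℂ) = 2 * (∑ i, (p i : ℂ) * (ρ i * ρ i).trace -
      ∑ i, ∑ j, (p i : ℂ) * p j * (ρ i * ρ j).trace) := by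
    rw [meanHS_sq hp]
    have hd : ∀ i j, ((p i * p j * distHS (ρ i) (ρ j) ^ 2 : ℝ) : ℂ)
        = (p i : ℂ) * (ρ i * ρ i).trace * p j + p i * ((p j : ℂ) * (ρ j * ρ j).trace)
          - 2 * ((p i : ℂ) * p j * (ρ i * ρ j).trace) := by
      intro i j
      rw [Complex.ofReal_mul, distHS_sq, Matrix.conjTranspose_sub, (hρ i).1.isHermitian.eq,
        (hρ j).1.isHermitian.eq, sub_mul, mul_sub, mul_sub]
      simp only [Matrix.trace_sub]
      rw [Matrix.trace_mul_comm (ρ j) (ρ i)]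
      push_cast
      ring
    simp only [Complex.ofReal_sum, hd, Finset.sum_sub_distrib, Finset.sum_add_distrib,
      ← Finset.mul_sum, ← Finset.sum_mul, h1]
    ring
  rw [hbar, dispersion, Complex.ofReal_div, h2]
  simp

lemma sum_trace_deviation_sq (hp : ∀ i, 0 < p i) (hp1 : ∑ i, p i = 1)
    (hρ : ∀ i, IsState (ρ i)) :
    ∑ i, (p i : ℂ) * (deviation p ρ i * deviation p ρ i).trace = dispersion p ρ := by
  have h1 : ∑ i, (p i : ℂ) = 1 := by exact_mod_cast hp1
  rw [dispersion_eq_purity_sub hp hp1 hρ]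
  simp only [deviation_eq hp]
  set B := ∑ j, (p j : ℂ) • ρ j with hB
  have h : ∀ i, (p i : ℂ) * ((ρ i - B) * (ρ i - B)).trace = (p i : ℂ) * (ρ i * ρ i).trace
      - 2 * (((p i : ℂ) • ρ i) * B).trace + p i * (B * B).trace := by
    intro i
    rw [sub_mul, mul_sub, mul_sub]
    simp only [Matrix.trace_sub, Matrix.smul_mul, Matrix.trace_smul, smul_eq_mul]
    rw [Matrix.trace_mul_comm B (ρ i)]
    ring
  simp only [h, Finset.sum_add_distrib, Finset.sum_sub_distrib, ← Finset.mul_sum, ← Finset.sum_mul,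
    ← Matrix.trace_sum, h1]
  rw [← hB]
  ring

lemma sum_pairWeight_trace (hp : ∀ i, 0 < p i) (hp1 : ∑ i, p i = 1) (hρ : ∀ i, IsState (ρ i)) :
    ∑ i, (p i : ℂ) * (ρ i * deviation p ρ i).trace = dispersion p ρ := by
  rw [dispersion_eq_purity_sub hp hp1 hρ]
  simp only [deviation_eq hp, mul_sub, Matrix.trace_sub, Finset.sum_sub_distrib]
  congr 1
  simp only [Finset.sum_mul, Matrix.trace_sum, Matrix.smul_mul, Matrix.trace_smul, smul_eq_mul]

/-- The squared deviation is positive semidefinite because the deviation is Hermitian, so the factor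
`ρ i`, being a state, can only decrease its trace. -/
lemma sum_trace_mul_deviation_sq_le (hp : ∀ i, 0 < p i) (hp1 : ∑ i, p i = 1)
    (hρ : ∀ i, IsState (ρ i)) :
    (∑ i, (p i : ℂ) * (ρ i * (deviation p ρ i * deviation p ρ i)).trace).re
      ≤ dispersion p ρ := by
  have h := congrArg Complex.re (sum_trace_deviation_sq hp hp1 hρ)
  rw [Complex.ofReal_re] at h
  rw [← h, Complex.re_sum, Complex.re_sum]
  refine Finset.sum_le_sum fun i _ => ?_
  rw [Complex.re_ofReal_mul, Complex.re_ofReal_mul]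
  refine mul_le_mul_of_nonneg_left ((hρ i).trace_mul_re_le ?_) (hp i).le
  have hH := deviation_isHermitian (p := p) hρ i
  conv in deviation p ρ i * _ => rw [← hH.eq]
  rw [hH.eq]
  conv => arg 1; arg 1; rw [← hH.eq]
  exact Matrix.posSemidef_conjTranspose_mul_self _

end Weights

/-! ### Permutations supported on the selected copies -/

section Lift
variable {k M : ℕ} {e : Fin k → Fin M}

/-- `π` permutes the range of `e` as `π'` permutes the indices, and fixes everything else. -/
def IsLift (e : Fin k → Fin M) (π' : Equiv.Perm (Fin k)) (π : Equiv.Perm (Fin M)) : Prop :=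
  (∀ j, π (e j) = e (π' j)) ∧ ∀ j, (∀ i, e i ≠ j) → π j = j

lemma isLift_swap (he : Function.Injective e) (a b : Fin k) :
    IsLift e (Equiv.swap a b) (Equiv.swap (e a) (e b)) :=
  ⟨fun _ => he.swap_apply a b _,
    fun j hj => Equiv.swap_apply_of_ne_of_ne (hj a).symm (hj b).symm⟩

lemma IsLift.mul {π₁ π₂ : Equiv.Perm (Fin k)} {σ₁ σ₂ : Equiv.Perm (Fin M)} (h₁ : IsLift e π₁ σ₁)
    (h₂ : IsLift e π₂ σ₂) : IsLift e (π₁ * π₂) (σ₁ * σ₂) :=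
  ⟨fun _ => by rw [Equiv.Perm.mul_apply, h₂.1, h₁.1, Equiv.Perm.mul_apply],
    fun j hj => by rw [Equiv.Perm.mul_apply, h₂.2 j hj, h₁.2 j hj]⟩

end Lift

/-! ### First and second moments of the weighted swaps -/

section Moments
variable {N d M : ℕ}

/-- The swap of the second registers of the copies `a` and `b`, weighted by `pairWeight`. -/
noncomputable def pairOp (p : Fin N → ℝ) (d : ℕ) (a b : Fin M) :
    Matrix (Fin M → Fin N × Fin d) (Fin M → Fin N × Fin d) ℂ :=
  permOp d (Equiv.swap a b) (fun I => (pairWeight p (I a) (I b) : ℂ))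

lemma pairOp_comm (p : Fin N → ℝ) (a b : Fin M) : pairOp p d a b = pairOp p d b a := by
  unfold pairOp
  rw [Equiv.swap_comm]
  congr 1
  ext I
  rw [pairWeight_comm]

lemma pairOp_isHermitian (p : Fin N → ℝ) (a b : Fin M) : (pairOp p d a b).IsHermitian :=
  permOp_isHermitian (Equiv.swap_mul_self a b) fun _ => Complex.conj_ofReal _

lemma pairOp_mul (p : Fin N → ℝ) (a b a' b' : Fin M) :
    pairOp p d a b * pairOp p d a' b' = permOp d (Equiv.swap a b * Equiv.swap a' b')
      (fun I => (pairWeight p (I a) (I b) : ℂ) * (pairWeight p (I a') (I b') : ℂ)) :=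
  permOp_mul _ _ _ _

variable {p : Fin N → ℝ} {ρ : Fin N → Matrix (Fin d) (Fin d) ℂ}

/-- The integrand of the expectation of `pairOp`. -/
noncomputable def pairKernel (p : Fin N → ℝ) (ρ : Fin N → Matrix (Fin d) (Fin d) ℂ)
    (y z : Fin N × Fin d) : ℂ :=
  (pairWeight p y.1 z.1 : ℂ) * (((p y.1 : ℂ) * ρ y.1 z.2 y.2) * ((p z.1 : ℂ) * ρ z.1 y.2 z.2))

lemma sum_pairKernel (hp : ∀ i, 0 < p i) (hp1 : ∑ i, p i = 1) (hρ : ∀ i, IsState (ρ i)) :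
    ∑ y, ∑ z, pairKernel p ρ y z = dispersion p ρ := by
  rw [← sum_pairWeight_trace hp hp1 hρ, Fintype.sum_prod_type]
  refine Finset.sum_congr rfl fun i _ => ?_
  simp only [Fintype.sum_prod_type, pairKernel, Matrix.trace, Matrix.diag, Matrix.mul_apply,
    deviation, Matrix.sum_apply, Matrix.smul_apply, smul_eq_mul, Finset.mul_sum]
  rw [Finset.sum_comm' (t' := Finset.univ) (s' := fun _ => Finset.univ) (by simp)]
  conv_rhs => rw [Finset.sum_comm]
  conv_rhs =>
    arg 2; ext s
    rw [Finset.sum_comm]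
  conv_rhs => rw [Finset.sum_comm]
  refine Finset.sum_congr rfl fun j _ => Finset.sum_congr rfl fun s _ =>
    Finset.sum_congr rfl fun t _ => ?_
  ring

section
variable (hp : ∀ i, 0 < p i) (hp1 : ∑ i, p i = 1) (hρ : ∀ i, IsState (ρ i))
include hp hp1 hρ

lemma trace_pairOp {a b : Fin M} (hab : a ≠ b) :
    (pairOp p d a b * tensorPower M (samplingState p ρ)).trace = dispersion p ρ := by
  have he : Function.Injective ![a, b] := by
    intro i j
    fin_cases i <;> fin_cases j <;> simp [hab, hab.symm]
  have hl := isLift_swap he 0 1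
  have h := trace_permOp_mul_tensorPower_of_injective hp1 hρ he hl.1 hl.2
    (fun J => (pairWeight p (J 0) (J 1) : ℂ))
  refine h.trans ?_
  rw [← sum_pairKernel hp hp1 hρ]
  simp [sum_fin_succ_pi, Fin.prod_univ_two, pairKernel]

/-- The swap squares to the identity, so the states enter only through their traces and the second
moment of the weight remains. -/
lemma trace_pairOp_mul_self {a b : Fin M} (hab : a ≠ b) :
    (pairOp p d a b * pairOp p d a b * tensorPower M (samplingState p ρ)).trace.re ≤ N := by
  have he : Function.Injective ![a, b] := by
    intro i j
    fin_cases i <;> fin_cases j <;> simp [hab, hab.symm]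
  have hl := (isLift_swap he 0 1).mul (isLift_swap he 0 1)
  have h := trace_permOp_mul_tensorPower_of_injective hp1 hρ he hl.1 hl.2
    (fun J => (pairWeight p (J 0) (J 1) : ℂ) * (pairWeight p (J 0) (J 1) : ℂ))
  rw [pairOp_mul]
  refine (congrArg Complex.re h).trans_le ?_
  have ht : ∀ i, ∑ s, ρ i s s = 1 := fun i => (hρ i).2
  have : (∑ y : Fin 2 → Fin N × Fin d,
      ((pairWeight p (y 0).1 (y 1).1 : ℂ) * (pairWeight p (y 0).1 (y 1).1 : ℂ)) *
        ∏ j, ((p (y j).1 : ℂ) * ρ (y j).1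
          (y ((Equiv.swap 0 1 * Equiv.swap 0 1 : Equiv.Perm (Fin 2)) j)).2 (y j).2))
      = ((∑ i, ∑ j, p i * p j * (pairWeight p i j * pairWeight p i j) : ℝ) : ℂ) := by
    rw [Equiv.swap_mul_self]
    simp only [sum_fin_succ_pi, Fin.prod_univ_two, Fintype.sum_prod_type, Equiv.Perm.one_apply]
    push_cast
    simp
    refine Finset.sum_congr rfl fun i _ => ?_
    rw [Finset.sum_comm]
    refine Finset.sum_congr rfl fun j _ => ?_
    calc _ = ∑ s, ∑ t, (p i : ℂ) * p j * (pairWeight p i j * pairWeight p i j) *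
          (ρ i s s * ρ j t t) := Finset.sum_congr rfl fun s _ => Finset.sum_congr rfl fun t _ => by
            ring
      _ = _ := by simp only [← Finset.mul_sum, ht, mul_one]
  refine (congrArg Complex.re this).trans_le ?_
  rw [Complex.ofReal_re]
  exact sum_pairWeight_sq_le hp hp1

/-- The product of the two swaps is a 3-cycle. Averaging over the two unshared copies turns each
weighted state into a deviation, leaving `∑ p_i Tr (ρ_i Δ_i²)`. -/
lemma trace_pairOp_mul_of_shared {a b c : Fin M} (hab : a ≠ b) (hac : a ≠ c) (hbc : b ≠ c) :
    (pairOp p d a b * pairOp p d a c * tensorPower M (samplingState p ρ)).trace.re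
      ≤ dispersion p ρ := by
  have he : Function.Injective ![a, b, c] := by
    intro i j
    fin_cases i <;> fin_cases j <;> simp [hab, hab.symm, hac, hac.symm, hbc, hbc.symm]
  have hl := (isLift_swap he 0 1).mul (isLift_swap he 0 2)
  have h := trace_permOp_mul_tensorPower_of_injective hp1 hρ he hl.1 hl.2
    (fun J => (pairWeight p (J 0) (J 1) : ℂ) * (pairWeight p (J 0) (J 2) : ℂ))
  rw [pairOp_mul]
  refine (congrArg Complex.re h).trans_le ?_
  refine le_trans (le_of_eq ?_) (sum_trace_mul_deviation_sq_le hp hp1 hρ)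
  congr 1
  have h0 : (Equiv.swap 0 1 * Equiv.swap 0 2 : Equiv.Perm (Fin 3)) 0 = 2 := by decide
  have h1 : (Equiv.swap 0 1 * Equiv.swap 0 2 : Equiv.Perm (Fin 3)) 1 = 0 := by decide
  have h2 : (Equiv.swap 0 1 * Equiv.swap 0 2 : Equiv.Perm (Fin 3)) 2 = 1 := by decide
  simp only [sum_fin_succ_pi, Fin.prod_univ_three, h0, h1, h2]
  simp [Fintype.sum_prod_type, -Equiv.Perm.coe_mul]
  refine Finset.sum_congr rfl fun i _ => ?_
  have hD : ∀ s t, deviation p ρ i s t = ∑ j, (p j : ℂ) * (pairWeight p i j : ℂ) * ρ j s t := by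
    intro s t
    simp [deviation, Matrix.sum_apply]
  calc _ = ∑ s, ∑ t, ∑ u, (p i : ℂ) * (ρ i u s * (deviation p ρ i s t * deviation p ρ i t u)) := by
        refine Finset.sum_congr rfl fun s _ => ?_
        rw [Finset.sum_comm]
        refine Finset.sum_congr rfl fun t _ => ?_
        simp only [hD, Finset.sum_mul_sum]
        simp only [Finset.mul_sum]
        conv_rhs =>
          rw [Finset.sum_comm]
          arg 2; ext j
          rw [Finset.sum_comm]
        refine Finset.sum_congr rfl fun j _ => Finset.sum_congr rfl fun k _ =>
          Finset.sum_congr rfl fun u _ => ?_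
        ring
    _ = _ := by
        simp only [Matrix.trace, Matrix.diag, Matrix.mul_apply, Finset.mul_sum]
        conv_rhs =>
          rw [Finset.sum_comm]
          arg 2; ext s
          rw [Finset.sum_comm]

/-- The four copies are independent and the integrand factors into two copies of `pairKernel`. -/
lemma trace_pairOp_mul_of_disjoint {a b a' b' : Fin M} (hab : a ≠ b) (hab' : a' ≠ b')
    (h1 : a' ≠ a) (h2 : a' ≠ b) (h3 : b' ≠ a) (h4 : b' ≠ b) :
    (pairOp p d a b * pairOp p d a' b' * tensorPower M (samplingState p ρ)).trace
      = (dispersion p ρ : ℂ) * dispersion p ρ := by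
  have he : Function.Injective ![a, b, a', b'] := by
    intro i j
    fin_cases i <;> fin_cases j <;> simp [hab, hab.symm, hab', hab'.symm, h1, h1.symm, h2, h2.symm,
      h3, h3.symm, h4, h4.symm]
  have hl := (isLift_swap he 0 1).mul (isLift_swap he 2 3)
  have h := trace_permOp_mul_tensorPower_of_injective hp1 hρ he hl.1 hl.2
    (fun J => (pairWeight p (J 0) (J 1) : ℂ) * (pairWeight p (J 2) (J 3) : ℂ))
  rw [pairOp_mul]
  refine h.trans ?_
  have e0 : (Equiv.swap 0 1 * Equiv.swap 2 3 : Equiv.Perm (Fin 4)) 0 = 1 := by decide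
  have e1 : (Equiv.swap 0 1 * Equiv.swap 2 3 : Equiv.Perm (Fin 4)) 1 = 0 := by decide
  have e2 : (Equiv.swap 0 1 * Equiv.swap 2 3 : Equiv.Perm (Fin 4)) 2 = 3 := by decide
  have e3 : (Equiv.swap 0 1 * Equiv.swap 2 3 : Equiv.Perm (Fin 4)) 3 = 2 := by decide
  rw [← sum_pairKernel hp hp1 hρ]
  simp only [sum_fin_succ_pi, Fin.prod_univ_four, e0, e1, e2, e3]
  simp only [Finset.univ_unique, Finset.sum_singleton, Finset.sum_mul, Finset.mul_sum]
  refine Finset.sum_congr rfl fun y0 _ => Finset.sum_congr rfl fun y1 _ =>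
    Finset.sum_congr rfl fun y2 _ => Finset.sum_congr rfl fun y3 _ => ?_
  simp [pairKernel]
  ring

/-- One bound covering every overlap pattern, with indicators so that it can be summed over pairs.
Coinciding pairs are overcounted, which is harmless because all terms are nonnegative. -/
lemma trace_pairOp_mul_le {a b a' b' : Fin M} (hab : a ≠ b) (hab' : a' ≠ b') :
    (pairOp p d a b * pairOp p d a' b' * tensorPower M (samplingState p ρ)).trace.re
      ≤ dispersion p ρ ^ 2 + dispersion p ρ * ((if a' = a then 1 else 0) +
          (if a' = b then 1 else 0) + (if b' = a then 1 else 0) + (if b' = b then 1 else 0))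
        + N * ((if a' = a then if b' = b then 1 else 0 else 0) +
          (if a' = b then if b' = a then 1 else 0 else 0)) := by
  have hθ := dispersion_nonneg (p := p) (ρ := ρ)
  have hN : (0 : ℝ) ≤ N := N.cast_nonneg
  have hs := sq_nonneg (dispersion p ρ)
  by_cases h1 : a' = a
  · subst h1
    by_cases h4 : b' = b
    · subst h4
      have := trace_pairOp_mul_self hp hp1 hρ hab (M := M)
      simp [hab, hab.symm]
      nlinarith
    · have := trace_pairOp_mul_of_shared hp hp1 hρ hab hab' (Ne.symm h4)
      simp [hab, hab'.symm, h4]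
      nlinarith
  by_cases h2 : a' = b
  · subst h2
    by_cases h3 : b' = a
    · subst h3
      have := trace_pairOp_mul_self hp hp1 hρ hab (M := M)
      rw [pairOp_comm p a' b']
      simp [hab, hab.symm]
      nlinarith
    · have := trace_pairOp_mul_of_shared hp hp1 hρ hab.symm hab' (Ne.symm h3)
      rw [pairOp_comm p a a']
      simp [h1, hab'.symm, h3]
      nlinarith
  by_cases h3 : b' = a
  · subst h3
    have := trace_pairOp_mul_of_shared hp hp1 hρ hab hab'.symm (Ne.symm h2)
    rw [pairOp_comm p a' b']
    simp [h1, h2, hab]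
    nlinarith
  by_cases h4 : b' = b
  · subst h4
    have := trace_pairOp_mul_of_shared hp hp1 hρ hab.symm hab'.symm (Ne.symm h1)
    rw [pairOp_comm p a' b', pairOp_comm p a b']
    simp [h1, h2, h3]
    nlinarith
  rw [trace_pairOp_mul_of_disjoint hp hp1 hρ hab hab' h1 h2 h3 h4, ← Complex.ofReal_mul,
    Complex.ofReal_re]
  simp [h1, h2, h3, h4]
  nlinarith

end

/-- The sum of the weighted swaps over all ordered pairs of distinct copies. -/
noncomputable def dispersionOp (p : Fin N → ℝ) (d M : ℕ) :
    Matrix (Fin M → Fin N × Fin d) (Fin M → Fin N × Fin d) ℂ :=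
  ∑ q ∈ (Finset.univ : Finset (Fin M)).offDiag, pairOp p d q.1 q.2

lemma dispersionOp_isHermitian (p : Fin N → ℝ) (d M : ℕ) : (dispersionOp p d M).IsHermitian := by
  unfold dispersionOp Matrix.IsHermitian
  rw [Matrix.conjTranspose_sum]
  exact Finset.sum_congr rfl fun q _ => pairOp_isHermitian p q.1 q.2

lemma card_offDiag_fin (M : ℕ) :
    (((Finset.univ : Finset (Fin M)).offDiag.card : ℕ) : ℝ) = M * (M - 1) := by
  rw [Finset.offDiag_card, Finset.card_univ, Fintype.card_fin,
    Nat.cast_sub (Nat.le_mul_self M)]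
  push_cast
  ring

section
variable (hp : ∀ i, 0 < p i) (hp1 : ∑ i, p i = 1) (hρ : ∀ i, IsState (ρ i))
include hp hp1 hρ

lemma trace_dispersionOp :
    (dispersionOp p d M * tensorPower M (samplingState p ρ)).trace.re
      = M * (M - 1) * dispersion p ρ := by
  unfold dispersionOp
  rw [Finset.sum_mul, Matrix.trace_sum, Complex.re_sum, ← card_offDiag_fin, ← nsmul_eq_mul]
  refine Finset.sum_eq_card_nsmul fun q hq => ?_
  rw [trace_pairOp hp hp1 hρ (by simpa using hq), Complex.ofReal_re]

/-- For a fixed ordered pair, each of the four one-copy coincidences occurs for at most `M` ordered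
pairs, and each of the two full coincidences, straight or reversed, for at most one. -/
lemma trace_dispersionOp_sq_le :
    (dispersionOp p d M * dispersionOp p d M * tensorPower M (samplingState p ρ)).trace.re
      ≤ (M * (M - 1) * dispersion p ρ) ^ 2 +
        M * (M - 1) * (4 * M * dispersion p ρ + 2 * N) := by
  set θ := dispersion p ρ
  have hθ : 0 ≤ θ := dispersion_nonneg
  set n : ℝ := M * (M - 1) with hn
  let P := (Finset.univ : Finset (Fin M)).offDiag
  have hmain : ∀ q ∈ P, ∑ r ∈ P, (pairOp p d q.1 q.2 * pairOp p d r.1 r.2 *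
      tensorPower M (samplingState p ρ)).trace.re ≤ n * θ ^ 2 + (4 * M * θ + 2 * N) := by
    intro q hq
    have hq' : q.1 ≠ q.2 := by simpa [P] using hq
    have hb : ∀ a : Fin M, ∑ r ∈ P, (if r.1 = a then (1 : ℝ) else 0) ≤ M := by
      intro a
      -- Enlarging the sum from distinct pairs to all pairs makes the count immediate.
      refine (Finset.sum_le_sum_of_subset_of_nonneg (Finset.subset_univ P) fun r _ _ => by
        split_ifs <;> norm_num).trans_eq ?_
      rw [Fintype.sum_prod_type, Finset.sum_comm]
      simp
    have hb' : ∀ a : Fin M, ∑ r ∈ P, (if r.2 = a then (1 : ℝ) else 0) ≤ M := by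
      intro a
      refine (Finset.sum_le_sum_of_subset_of_nonneg (Finset.subset_univ P) fun r _ _ => by
        split_ifs <;> norm_num).trans_eq ?_
      rw [Fintype.sum_prod_type]
      simp
    have hc : ∀ a b : Fin M,
        ∑ r ∈ P, (if r.1 = a then if r.2 = b then (1 : ℝ) else 0 else 0) ≤ 1 := by
      intro a b
      refine (Finset.sum_le_sum_of_subset_of_nonneg (Finset.subset_univ P) fun r _ _ => by
        split_ifs <;> norm_num).trans_eq ?_
      rw [Fintype.sum_prod_type, Finset.sum_comm]
      simp
    refine (Finset.sum_le_sum fun r hr =>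
      trace_pairOp_mul_le hp hp1 hρ hq' (by simpa [P] using hr)).trans ?_
    rw [Finset.sum_add_distrib, Finset.sum_add_distrib, ← Finset.mul_sum, ← Finset.mul_sum,
      Finset.sum_add_distrib, Finset.sum_add_distrib, Finset.sum_add_distrib,
      Finset.sum_add_distrib, Finset.sum_const, nsmul_eq_mul, card_offDiag_fin]
    have h1 := mul_le_mul_of_nonneg_left (add_le_add (add_le_add (add_le_add (hb q.1) (hb q.2))
      (hb' q.1)) (hb' q.2)) hθ
    have h2 := mul_le_mul_of_nonneg_left (add_le_add (hc q.1 q.2) (hc q.2 q.1))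
      (Nat.cast_nonneg N : (0 : ℝ) ≤ N)
    linarith
  have h := Finset.sum_le_sum hmain
  rw [Finset.sum_const, nsmul_eq_mul, card_offDiag_fin, ← hn] at h
  unfold dispersionOp
  rw [Finset.sum_mul_sum, Finset.sum_mul, Matrix.trace_sum, Complex.re_sum]
  simp only [Finset.sum_mul, Matrix.trace_sum, Complex.re_sum]
  refine h.trans_eq ?_
  ring

end

end Moments

/-! ### Choice of constants and conclusion -/

/-- The test that always accepts. -/
def alwaysAccept (ι : Type*) [Fintype ι] [DecidableEq ι] (M : ℕ) : TwoOutcomeTest ι M where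
  accept := 1
  reject := 0
  accept_posSemidef := Matrix.PosSemidef.one
  reject_posSemidef := Matrix.PosSemidef.zero
  add_eq_one := add_zero 1

lemma alwaysAccept_acceptProb {ι : Type*} [Fintype ι] [DecidableEq ι] {M : ℕ} {σ : Matrix ι ι ℂ}
    (hσ : IsState σ) : (alwaysAccept ι M).acceptProb σ = 1 := by
  simp [TwoOutcomeTest.acceptProb, alwaysAccept, hσ.tensorPower_trace]

/-- The Chebyshev ratio with `s = √N`, `m = M`. From `C * s ≤ m * δ` and `s ≥ 1` follows `C ≤ m *
δ`, which controls the term in `θ`; squaring the former and using `C ≥ 1` controls `s ^ 2`. The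
factor `2` lost in each comes from `m ^ 2 ≤ 2 * (m * (m - 1))`, valid for `m ≥ 2`. -/
lemma variance_div_le {C δ s m θ g : ℝ} (hC : 1 ≤ C) (hδ : 0 < δ) (hs : 1 ≤ s) (hm : 2 ≤ m)
    (hCm : C * (s / δ) ≤ m) (hθ : 0 ≤ θ) (hg : 0 < g) :
    m * (m - 1) * (4 * m * θ + 2 * s ^ 2) / (m * (m - 1) * g) ^ 2
      ≤ (8 * θ * δ + 4 * δ ^ 2) / C / g ^ 2 := by
  have hC0 : 0 < C := by linarith
  have hsm : C * s ≤ m * δ := by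
    rw [← mul_div_assoc, div_le_iff₀ hδ] at hCm
    exact hCm
  have hm0 : 0 < m := by linarith
  have hn : 0 < m * (m - 1) := mul_pos hm0 (by linarith)
  have hn2 : m ^ 2 ≤ 2 * (m * (m - 1)) := by nlinarith
  have e1 : m * (m - 1) * (4 * m * θ + 2 * s ^ 2) / (m * (m - 1) * g) ^ 2
      = (4 * m * θ + 2 * s ^ 2) / (m * (m - 1)) / g ^ 2 := by
    have := hn.ne'
    have h1 : m - 1 ≠ 0 := by linarith
    field_simp
  rw [e1]
  refine div_le_div_of_nonneg_right ?_ (by positivity)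
  rw [div_le_div_iff₀ hn hC0]
  have hCs : C ≤ m * δ := le_trans (by nlinarith) hsm
  have h1 : m * θ * C ≤ 2 * θ * δ * (m * (m - 1)) := by
    have a1 : m * θ * C ≤ m * θ * (m * δ) := mul_le_mul_of_nonneg_left hCs (by positivity)
    have a2 : θ * δ * m ^ 2 ≤ θ * δ * (2 * (m * (m - 1))) :=
      mul_le_mul_of_nonneg_left hn2 (by positivity)
    nlinarith
  have h2 : s ^ 2 * C ≤ 2 * δ ^ 2 * (m * (m - 1)) := by
    have a0 : s ^ 2 * C ≤ (C * s) ^ 2 := by nlinarith [mul_nonneg (sq_nonneg s) hC0.le]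
    have a1 : (C * s) ^ 2 ≤ (m * δ) ^ 2 := pow_le_pow_left₀ (by positivity) hsm 2
    have a2 : δ ^ 2 * m ^ 2 ≤ δ ^ 2 * (2 * (m * (m - 1))) :=
      mul_le_mul_of_nonneg_left hn2 (by positivity)
    nlinarith
  nlinarith

end QuantumCollection

open QuantumCollection in
theorem theorem4 :
    ∀ η : ℝ, 0 < η → η < 1 / 2 →
      ∃ C : ℝ, 0 < C ∧
        ∀ (N d : ℕ) (p : Fin N → ℝ), (∀ i, 0 < p i) → ∑ i, p i = 1 →
          ∀ δ : ℝ, 0 < δ →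
            ∀ M : ℕ, C * (Real.sqrt N / δ) ≤ M →
              ∃ T : QuantumCollection.TwoOutcomeTest (Fin N × Fin d) M,
                ∀ ρ : Fin N → Matrix (Fin d) (Fin d) ℂ,
                  (∀ i, QuantumCollection.IsState (ρ i)) →
                    (QuantumCollection.meanHS p ρ ^ 2 ≤ 0.99 * δ →
                      1 - η < T.acceptProb (QuantumCollection.samplingState p ρ)) ∧
                    (δ < QuantumCollection.meanHS p ρ ^ 2 →
                      T.acceptProb (QuantumCollection.samplingState p ρ) < η) := by
  intro η hη hη2
  have hC1 : 2000000 ≤ 2000000 / η := by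
    rw [le_div_iff₀ hη]
    linarith
  have hηC : η = 2000000 / (2000000 / η) := by
    field_simp
  refine ⟨2000000 / η, by positivity, fun N d p hp hp1 δ hδ M hM => ?_⟩
  set C := 2000000 / η
  have hC0 : 0 < C := by linarith
  have hN : 1 ≤ N := by
    rcases Nat.eq_zero_or_pos N with h | h
    · subst h
      simp at hp1
    · exact h
  have hs : 1 ≤ Real.sqrt N := Real.one_le_sqrt.2 (by exact_mod_cast hN)
  -- With at most one copy there is no pair to swap. Then `C * √N ≤ δ` makes `δ` exceed `2`, so the
  -- rejection case is vacuous.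
  by_cases hM2 : M < 2
  · refine ⟨alwaysAccept _ M, fun ρ hρ => ⟨fun _ => ?_, fun h => ?_⟩⟩
    · rw [alwaysAccept_acceptProb (samplingState_isState hp hp1 hρ)]
      linarith
    · exfalso
      have h2 := meanHS_sq_le_two hp hp1 hρ
      have hM1 : (M : ℝ) ≤ 1 := by exact_mod_cast Nat.lt_succ_iff.1 hM2
      rw [← mul_div_assoc, div_le_iff₀ hδ] at hM
      nlinarith
  have hM2' : (2 : ℝ) ≤ M := by exact_mod_cast not_lt.1 hM2
  have hn : (0 : ℝ) < M * (M - 1) := mul_pos (by linarith) (by linarith)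
  -- In terms of `θ` the two cases are `θ ≤ 0.495 * δ` and `θ > 0.5 * δ`; the threshold is the
  -- midpoint.
  refine ⟨thresholdTest (dispersionOp_isHermitian p d M) (M * (M - 1) * (0.4975 * δ)),
    fun ρ hρ => ?_⟩
  have hσ := samplingState_isState hp hp1 hρ
  have hθ := dispersion_nonneg (p := p) (ρ := ρ)
  have hmθ : meanHS p ρ ^ 2 = 2 * dispersion p ρ := by
    unfold dispersion
    ring
  have hNs : (N : ℝ) = Real.sqrt N ^ 2 := (Real.sq_sqrt N.cast_nonneg).symm
  rw [hmθ]
  constructor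
  · intro h
    have hg : 0 < 0.4975 * δ - dispersion p ρ := by linarith
    refine lt_of_lt_of_le ?_ (one_sub_le_thresholdTest_acceptProb (dispersionOp_isHermitian p d M)
      hσ.tensorPower_posSemidef hσ.tensorPower_trace (trace_dispersionOp hp hp1 hρ)
      (trace_dispersionOp_sq_le hp hp1 hρ) (mul_lt_mul_of_pos_left (sub_pos.1 hg) hn))
    refine sub_lt_sub_left ?_ _
    rw [← mul_sub, hNs]
    refine (variance_div_le (by linarith) hδ hs hM2' hM hθ hg).trans_lt ?_
    rw [div_lt_iff₀ (by positivity), hηC, div_mul_eq_mul_div]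
    refine div_lt_div_of_pos_right ?_ hC0
    -- Here `8θδ + 4δ² ≤ 7.96 δ²`, while `2000000 * (0.0025 δ)² = 12.5 δ²`; this is what fixes the
    -- size of the constant.
    have hg2 : 0.0025 * δ ≤ 0.4975 * δ - dispersion p ρ := by linarith
    have := pow_le_pow_left₀ (by positivity) hg2 2
    nlinarith [mul_pos hδ hδ]
  · intro h
    have hg : 0 < dispersion p ρ - 0.4975 * δ := by linarith
    refine lt_of_le_of_lt (thresholdTest_acceptProb_le (dispersionOp_isHermitian p d M)
      hσ.tensorPower_posSemidef hσ.tensorPower_trace (trace_dispersionOp hp hp1 hρ)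
      (trace_dispersionOp_sq_le hp hp1 hρ) (mul_lt_mul_of_pos_left (sub_pos.1 hg) hn)) ?_
    rw [← mul_sub, hNs]
    refine (variance_div_le (by linarith) hδ hs hM2' hM hθ hg).trans_lt ?_
    rw [div_lt_iff₀ (by positivity), hηC, div_mul_eq_mul_div]
    refine div_lt_div_of_pos_right ?_ hC0
    -- As `θ` may far exceed `δ`, the gap is measured against `θ`: from `δ < 2θ`, the numerator is
    -- below `32 θ²`, while `2000000 * (0.005 θ)² = 50 θ²`.
    have hg2 : 0.005 * dispersion p ρ ≤ dispersion p ρ - 0.4975 * δ := by linarith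
    have := pow_le_pow_left₀ (by positivity) hg2 2
    nlinarith [mul_pos hδ hδ]
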